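/- Let $n,m\ge 1$, let $x_1,\dots,x_n\in\mathbb R^d$ be distinct, let $y_1,\dots,y_m\in\mathbb R^d$ be distinct, and let $a_i>0$, $b_j>0$ with $\sum_{i=1}^n a_i=\sum_{j=1}^m b_j=1$ (so that $\mu=\sum_i a_i\delta_{x_i}$ and $\nu=\sum_j b_j\delta_{y_j}$ are discrete probability measures). Let $\gamma$ be a probability measure on $\mathbb R^d\times\mathbb R^d$ with a continuous, bounded, everywhere positive density $\rho$ with respect to Lebesgue measure. For $(\alpha,\beta)\in\mathbb R^{n}\times\mathbb R^{m}$ put $f(x,\alpha)=\max_{i}\{\langle x,x_i\rangle+\alpha_i\}$, $g(y,\beta)=\max_{j}\{\langle y,y_j\rangle+\beta_j\}$, $A_i(\alpha)=\{x: f(x,\alpha)=\langle x,x_i\rangle+\alpha_i\}$, $B_j(\beta)=\{y: g(y,\beta)=\langle y,y_j\rangle+\beta_j\}$, and $$U(\alpha,\beta)=\sum_{i=1}^n a_i\Bigl(\alpha_i+\tfrac12\|x_i\|^2\Bigr)+\sum_{j=1}^m b_j\Bigl(\beta_j+\tfrac12\|y_j\|^2\Bigr)-\int e^{f(x,\alpha)+g(y,\beta)-\frac12\|x\|^2-\frac12\|y\|^2}\,d\gamma(x,y)+1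 .$$ Then $U$ is differentiable on $\mathbb R^{n+m}$, with $$\partial_{\alpha_i}U(\alpha,\beta)=a_i-\int_{A_i(\alpha)\times\mathbb R^d}e^{f(x,\alpha)+g(y,\beta)-\frac12\|x\|^2-\frac12\|y\|^2}\,d\gamma,\qquad \partial_{\beta_j}U(\alpha,\beta)=b_j-\int_{\mathbb R^d\times B_j(\beta)}e^{f(x,\alpha)+g(y,\beta)-\frac12\|x\|^2-\frac12\|y\|^2}\,d\gamma ,$$ and $U$ has a maximizer $(\alpha^*,\beta^*)$ on $\mathbb R^{n+m}$, which is unique up to replacing $(\alpha^*,\beta^*)$ by $(\alpha^*+r\mathbf 1,\beta^*-r\mathbf 1)$, $r\in\mathbb R$. For every initial point $(\alpha^0,\beta^0)\in\mathbb R^{n+m}$ there is $\eta_0>0$ such that for every step size $0<\eta<\eta_0$ there is $\theta\in(0,1)$ for which the gradient ascent iterates $(\alpha^{t+1},\beta^{t+1})=(\alpha^t,\beta^t)+\eta\,\nabla U(\alpha^t,\beta^t)$ satisfy $$\|(\alpha^t,\beta^t)-(\alpha^*,\beta^*)\|_{l^2_\oplus}=O(\theta^t)\quad\text{as } t\to\infty,\qquad\text{where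 } \|(u,v)\|_{l^2_\oplus}=\Bigl(\sum_{i=1}^n\sum_{j=1}^m (u_i+v_j)^2\Bigr)^{1/2}.$$ -/

import Mathlib

open MeasureTheory Filter Asymptotics

noncomputable section

namespace RelaxedBridge

/-- The parameter space `ℝ^{n+m}` of pairs `(α, β)`, with its Euclidean structure: for
`z : Param n m`, the entry `α i` is `z (Sum.inl i)` and the entry `β j` is `z (Sum.inr j)`. -/
abbrev Param (n m : ℕ) : Type := EuclideanSpace ℝ (Fin n ⊕ Fin m)

/-- The component `α` of `z = (α, β)`. -/
def alpha {n m : ℕ} (z : Param n m) : Fin n → ℝ := fun i => z (Sum.inl i)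

/-- The component `β` of `z = (α, β)`. -/
def beta {n m : ℕ} (z : Param n m) : Fin m → ℝ := fun j => z (Sum.inr j)

/-- The max-affine function `u ↦ sup_i (⟨u, p i⟩ + w i)`; it is `f(·, α)` for the points `x_i`
and the weights `α`, and `g(·, β)` for the points `y_j` and the weights `β`. -/
def maxAffine {d k : ℕ} (p : Fin k → EuclideanSpace ℝ (Fin d)) (w : Fin k → ℝ)
    (u : EuclideanSpace ℝ (Fin d)) : ℝ :=
  ⨆ i, (inner ℝ u (p i) + w i)

/-- The Laguerre cell of index `i`: the points where the maximum in `maxAffine` is attained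
at `i`. -/
def laguerreCell {d k : ℕ} (p : Fin k → EuclideanSpace ℝ (Fin d)) (w : Fin k → ℝ) (i : Fin k) :
    Set (EuclideanSpace ℝ (Fin d)) :=
  {u | maxAffine p w u = inner ℝ u (p i) + w i}

/-- The integrand `exp (f(x, α) + g(y, β) - ‖x‖² / 2 - ‖y‖² / 2)` at `q = (x, y)`. -/
def expIntegrand {n m d : ℕ} (x : Fin n → EuclideanSpace ℝ (Fin d))
    (y : Fin m → EuclideanSpace ℝ (Fin d)) (z : Param n m)
    (q : EuclideanSpace ℝ (Fin d) × EuclideanSpace ℝ (Fin d)) : ℝ :=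
  Real.exp (maxAffine x (alpha z) q.1 + maxAffine y (beta z) q.2
    - ‖q.1‖ ^ 2 / 2 - ‖q.2‖ ^ 2 / 2)

/-- The dual objective `U(α, β)`. -/
def dualObjective {n m d : ℕ} (a : Fin n → ℝ) (b : Fin m → ℝ)
    (x : Fin n → EuclideanSpace ℝ (Fin d)) (y : Fin m → EuclideanSpace ℝ (Fin d))
    (γ : Measure (EuclideanSpace ℝ (Fin d) × EuclideanSpace ℝ (Fin d)))
    (z : Param n m) : ℝ :=
  ∑ i, a i * (alpha z i + ‖x i‖ ^ 2 / 2) + ∑ j, b j * (beta z j + ‖y j‖ ^ 2 / 2)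
    - ∫ q, expIntegrand x y z q ∂γ + 1

/-- The explicit vector whose entries are
`a i - ∫_{A_i(α) × ℝ^d} exp (f + g - ‖x‖² / 2 - ‖y‖² / 2) dγ` and
`b j - ∫_{ℝ^d × B_j(β)} exp (f + g - ‖x‖² / 2 - ‖y‖² / 2) dγ`. -/
def explicitGradient {n m d : ℕ} (a : Fin n → ℝ) (b : Fin m → ℝ)
    (x : Fin n → EuclideanSpace ℝ (Fin d)) (y : Fin m → EuclideanSpace ℝ (Fin d))
    (γ : Measure (EuclideanSpace ℝ (Fin d) × EuclideanSpace ℝ (Fin d)))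
    (z : Param n m) : Param n m :=
  WithLp.toLp 2 (Sum.elim
    (fun i => a i - ∫ q in laguerreCell x (alpha z) i ×ˢ Set.univ, expIntegrand x y z q ∂γ)
    (fun j => b j - ∫ q in Set.univ ×ˢ laguerreCell y (beta z) j, expIntegrand x y z q ∂γ))

/-- Gradient ascent on `U` with step size `η` started at `z₀`:
`z_{t+1} = z_t + η ∇U(z_t)`. -/
def gradientAscent {n m d : ℕ} (a : Fin n → ℝ) (b : Fin m → ℝ)
    (x : Fin n → EuclideanSpace ℝ (Fin d)) (y : Fin m → EuclideanSpace ℝ (Fin d))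
    (γ : Measure (EuclideanSpace ℝ (Fin d) × EuclideanSpace ℝ (Fin d)))
    (η : ℝ) (z₀ : Param n m) : ℕ → Param n m
  | 0 => z₀
  | t + 1 => gradientAscent a b x y γ η z₀ t
      + η • gradient (dualObjective a b x y γ) (gradientAscent a b x y γ η z₀ t)

/-- `(α, β) ∼_⊕ (α', β')`: there is `r` with `α = α' + r 𝟏` and `β = β' - r 𝟏`. -/
def OplusEquiv {n m : ℕ} (z z' : Param n m) : Prop :=
  ∃ r : ℝ, (∀ i, alpha z i = alpha z' i + r) ∧ (∀ j, beta z j = beta z' j - r)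

/-- The `l²_⊕` norm `‖(α_i + β_j)_{i,j}‖_{l²}`, evaluated on a representative `(α, β)` of a class
modulo `∼_⊕`. -/
def l2Oplus {n m : ℕ} (z : Param n m) : ℝ :=
  Real.sqrt (∑ i, ∑ j, (alpha z i + beta z j) ^ 2)

/-- `z` maximizes the dual objective over `ℝ^{n+m}`. -/
def IsDualOptimizer {n m d : ℕ} (a : Fin n → ℝ) (b : Fin m → ℝ)
    (x : Fin n → EuclideanSpace ℝ (Fin d)) (y : Fin m → EuclideanSpace ℝ (Fin d))
    (γ : Measure (EuclideanSpace ℝ (Fin d) × EuclideanSpace ℝ (Fin d)))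
    (z : Param n m) : Prop :=
  ∀ w : Param n m, dualObjective a b x y γ w ≤ dualObjective a b x y γ z

end RelaxedBridge

end

/-! Write D_ij for the increment of α_i + β_j and c_ij for the mass of the integrand on A_i × B_j.
The integral at the perturbed point is compared with the model Σ c_ij (1 + D_ij). On A_i × B_j the
pair (i, j) still competes after the perturbation, so the integral is at least Σ c_ij exp D_ij. This
makes the explicit gradient a supergradient of U, with a second-order gain wherever c_ij > 0.
Conversely, (i, j) stays optimal except within O(‖δ‖) of a tie; that set has mass O(‖δ‖) and carries
an error O(‖δ‖), so the loss is O(‖δ‖²). Both bounds together give differentiability and a one-sided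
smoothness estimate (`dualObjective_add_le`, `le_dualObjective_add`).

Averaging with weights a_i b_j shows that U tends to -∞ with the sums α_i + β_j, so a maximizer
exists modulo shifts. There the gradient vanishes, all cells have positive mass, and the
second-order gain yields uniqueness and quadratic growth. Concavity bounds the gap by ‖∇U‖ times the
distance to the maximizer; with quadratic growth this is a Polyak–Łojasiewicz inequality on the
initial superlevel set, whence `gradientAscent_linear_rate`. -/

noncomputable section

namespace RelaxedBridge

/-! ### Max-affine functions and their near-ties. -/

section MaxAffine

variable {d k : ℕ} (p : Fin k → EuclideanSpace ℝ (Fin d)) (w v : Fin k → ℝ)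
  (u : EuclideanSpace ℝ (Fin d))

theorem le_maxAffine (i : Fin k) : inner ℝ u (p i) + w i ≤ maxAffine p w u :=
  le_ciSup (f := fun i => inner ℝ u (p i) + w i) (Set.finite_range _).bddAbove i

theorem exists_mem_laguerreCell [Nonempty (Fin k)] : ∃ i, u ∈ laguerreCell p w i := by
  obtain ⟨i, hi⟩ := exists_eq_ciSup_of_finite (f := fun i => inner ℝ u (p i) + w i)
  exact ⟨i, hi.symm⟩

theorem measurable_maxAffine : Measurable (maxAffine p w) := by
  unfold maxAffine
  exact Measurable.iSup fun i => by fun_prop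

theorem measurableSet_laguerreCell (i : Fin k) : MeasurableSet (laguerreCell p w i) :=
  measurableSet_eq_fun (measurable_maxAffine p w) (by fun_prop)

theorem maxAffine_add_le [Nonempty (Fin k)] {r : ℝ} (hv : ∀ i, v i ≤ r) :
    maxAffine p (w + v) u ≤ maxAffine p w u + r := by
  refine ciSup_le fun i => ?_
  have := le_maxAffine p w u i
  have := hv i
  simp only [Pi.add_apply]
  linarith

theorem add_le_maxAffine_add {i : Fin k} (hi : u ∈ laguerreCell p w i) :
    maxAffine p w u + v i ≤ maxAffine p (w + v) u := by
  have h := le_maxAffine p (w + v) u i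
  rw [laguerreCell, Set.mem_ofPred_eq] at hi
  simp only [Pi.add_apply] at h
  linarith

/-- The points where two of the affine functions differ by at most `r`. -/
def tieSlab (r : ℝ) : Set (EuclideanSpace ℝ (Fin d)) :=
  ⋃ ik : {ik : Fin k × Fin k // ik.1 ≠ ik.2},
    {u | |inner ℝ u (p ik.1.1 - p ik.1.2) + (w ik.1.1 - w ik.1.2)| ≤ r}

theorem measurableSet_tieSlab (r : ℝ) : MeasurableSet (tieSlab p w r) :=
  MeasurableSet.iUnion fun _ => measurableSet_le (by fun_prop) measurable_const

theorem laguerreCell_inter_subset_tieSlab {i j : Fin k} (hij : i ≠ j) :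
    laguerreCell p w i ∩ laguerreCell p w j ⊆ tieSlab p w 0 := by
  rintro u ⟨hi, hj⟩
  rw [laguerreCell, Set.mem_ofPred_eq] at hi hj
  refine Set.mem_iUnion.2 ⟨⟨(i, j), hij⟩, ?_⟩
  simp only [Set.mem_ofPred_eq, inner_sub_right, abs_nonpos_iff]
  linarith

/-- Weights moving by at most `r` change the gap between two affine pieces by at most `2 * r`, so a
lead larger than that survives. -/
theorem maxAffine_add_eq_of_notMem_tieSlab [Nonempty (Fin k)] {r : ℝ} (hv : ∀ i, |v i| ≤ r)
    {i : Fin k} (hi : u ∈ laguerreCell p w i) (hu : u ∉ tieSlab p w (2 * r)) :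
    maxAffine p (w + v) u = maxAffine p w u + v i := by
  refine le_antisymm (ciSup_le fun j => ?_) (add_le_maxAffine_add p w v u hi)
  rw [laguerreCell, Set.mem_ofPred_eq] at hi
  simp only [Pi.add_apply]
  by_cases hij : i = j
  · subst hij; linarith
  have h1 : ¬ |inner ℝ u (p i - p j) + (w i - w j)| ≤ 2 * r := fun h =>
    hu (Set.mem_iUnion.2 ⟨⟨(i, j), hij⟩, h⟩)
  have h2 := le_maxAffine p w u j
  rw [inner_sub_right, abs_of_nonneg (by linarith)] at h1
  have := abs_le.1 (hv i)
  have := abs_le.1 (hv j)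
  linarith

end MaxAffine

/-! ### Gaussian mass of slabs. -/

section Gaussian

variable {d : ℕ}

/-- The measure with density `exp (-‖u‖² / 4)`. -/
def gaussMeasure (d : ℕ) : Measure (EuclideanSpace ℝ (Fin d)) :=
  volume.withDensity fun u => ENNReal.ofReal (Real.exp (-‖u‖ ^ 2 / 4))

theorem integrable_exp_neg_sq_div : Integrable fun s : ℝ => Real.exp (-s ^ 2 / 4) := by
  convert integrable_exp_neg_mul_sq (b := 1 / 4) (by norm_num) using 3
  ring

theorem lintegral_exp_neg_sq_div_ne_top :
    ∫⁻ s : ℝ, ENNReal.ofReal (Real.exp (-s ^ 2 / 4)) ≠ ⊤ :=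
  integrable_exp_neg_sq_div.lintegral_lt_top.ne

theorem lintegral_exp_neg_sq_div_ne_zero :
    ∫⁻ s : ℝ, ENNReal.ofReal (Real.exp (-s ^ 2 / 4)) ≠ 0 := by
  rw [← ofReal_integral_eq_lintegral_ofReal integrable_exp_neg_sq_div
    (ae_of_all _ fun _ => (Real.exp_pos _).le)]
  simpa using integral_exp_pos integrable_exp_neg_sq_div

theorem exp_neg_norm_sq_div_eq_prod (u : EuclideanSpace ℝ (Fin d)) :
    ENNReal.ofReal (Real.exp (-‖u‖ ^ 2 / 4)) =
      ∏ i, ENNReal.ofReal (Real.exp (-(u i) ^ 2 / 4)) := by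
  rw [← ENNReal.ofReal_prod_of_nonneg fun _ _ => (Real.exp_pos _).le, ← Real.exp_sum,
    EuclideanSpace.real_norm_sq_eq]
  simp only [neg_div, Finset.sum_neg_distrib, Finset.sum_div]

theorem gaussMeasure_apply {s : Set (EuclideanSpace ℝ (Fin d))} (hs : MeasurableSet s) :
    gaussMeasure d s = ∫⁻ u : Fin d → ℝ, s.indicator 1 (WithLp.toLp 2 u) *
      ∏ i, ENNReal.ofReal (Real.exp (-(u i) ^ 2 / 4)) := by
  rw [gaussMeasure, withDensity_apply _ hs, ← lintegral_indicator hs,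
    ← (PiLp.volume_preserving_toLp (Fin d)).lintegral_comp]
  · refine lintegral_congr fun u => ?_
    by_cases h : WithLp.toLp 2 u ∈ s <;> simp [h, exp_neg_norm_sq_div_eq_prod]
  · exact Measurable.indicator (by fun_prop) hs

instance : IsFiniteMeasure (gaussMeasure d) := by
  refine ⟨?_⟩
  rw [gaussMeasure_apply MeasurableSet.univ]
  simp only [Set.indicator_univ, Pi.one_apply, one_mul]
  simp only [← ENNReal.ofReal_prod_of_nonneg fun _ _ => (Real.exp_pos _).le]
  exact (Integrable.fintype_prod fun _ : Fin d => integrable_exp_neg_sq_div).lintegral_lt_top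

theorem volume_setOf_abs_mul_add_le {a : ℝ} (ha : a ≠ 0) (c r : ℝ) :
    volume {s : ℝ | |s * a + c| ≤ r} ≤ ENNReal.ofReal (2 / |a|) * ENNReal.ofReal r := by
  have : {s : ℝ | |s * a + c| ≤ r} ⊆ Metric.closedBall (-c / a) (r / |a|) := by
    intro s hs
    rw [Metric.mem_closedBall, Real.dist_eq, le_div_iff₀ (abs_pos.2 ha), ← abs_mul]
    refine le_of_eq_of_le ?_ hs
    congr 1
    field_simp
    ring
  refine (measure_mono this).trans ?_
  rw [Real.volume_closedBall, ← ENNReal.ofReal_mul (by positivity)]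
  exact le_of_eq (by congr 1; ring)

/-- Freeze all coordinates but one with `v k ≠ 0`: the slab cuts out an interval of length at most
2r/|v k|, on which the one-dimensional weight is at most 1. The bound does not see the offset `c`,
hence is uniform in the weights later. -/
theorem gaussMeasure_slab_le {v : EuclideanSpace ℝ (Fin d)} (hv : v ≠ 0) :
    ∃ C : ENNReal, C ≠ ⊤ ∧ ∀ c r : ℝ,
      gaussMeasure d {u | |inner ℝ u v + c| ≤ r} ≤ C * ENNReal.ofReal r := by
  obtain ⟨k, hk⟩ : ∃ k, v k ≠ 0 := by
    by_contra! h
    exact hv (by ext i; simpa using h i)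
  set G : ENNReal := ∫⁻ s : ℝ, ENNReal.ofReal (Real.exp (-s ^ 2 / 4)) with hG
  have hG0 : G ≠ 0 := lintegral_exp_neg_sq_div_ne_zero
  have hGt : G ≠ ⊤ := lintegral_exp_neg_sq_div_ne_top
  -- Dividing by `G` removes the factor of coordinate `k` from the total mass.
  refine ⟨ENNReal.ofReal (2 / |v k|) / G * gaussMeasure d Set.univ,
    ENNReal.mul_ne_top (ENNReal.div_ne_top ENNReal.ofReal_ne_top hG0) (measure_ne_top _ _),
    fun c r => ?_⟩
  have hs : MeasurableSet {u : EuclideanSpace ℝ (Fin d) | |inner ℝ u v + c| ≤ r} :=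
    measurableSet_le (by fun_prop) measurable_const
  rw [gaussMeasure_apply hs, gaussMeasure_apply MeasurableSet.univ]
  simp only [Set.indicator_univ, Pi.one_apply, one_mul]
  set W : (Fin d → ℝ) → ENNReal := fun u => ∏ i, ENNReal.ofReal (Real.exp (-(u i) ^ 2 / 4))
    with hW
  have hWm : Measurable W := by fun_prop
  set K := ENNReal.ofReal (2 / |v k|) / G * ENNReal.ofReal r with hK
  have key : ∫⁻ u : Fin d → ℝ, {u | |inner ℝ u v + c| ≤ r}.indicator 1 (WithLp.toLp 2 u) * W u
      ≤ ∫⁻ u : Fin d → ℝ, K * W u := by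
    -- The base point 0 is arbitrary, since every coordinate gets integrated; coordinate `k` goes
    -- first.
    rw [volume_pi, lintegral_eq_lmarginal_univ 0, lintegral_eq_lmarginal_univ 0,
      lmarginal_erase' _ ?_ (Finset.mem_univ k), lmarginal_erase' _ ?_ (Finset.mem_univ k)]
    rotate_left
    · fun_prop
    · refine Measurable.mul ?_ hWm
      exact (measurable_one.indicator hs).comp (by fun_prop)
    refine lmarginal_mono (fun u => ?_) 0
    have hupd : ∀ s, W (Function.update u k s) = ENNReal.ofReal (Real.exp (-s ^ 2 / 4)) *
        ∏ i ∈ Finset.univ.erase k, ENNReal.ofReal (Real.exp (-(u i) ^ 2 / 4)) := by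
      intro s
      rw [hW]
      simp only
      rw [← Finset.mul_prod_erase _ _ (Finset.mem_univ k)]
      congr 1
      · simp
      · refine Finset.prod_congr rfl fun i hi => ?_
        rw [Function.update_of_ne (Finset.ne_of_mem_erase hi)]
    set P := ∏ i ∈ Finset.univ.erase k, ENNReal.ofReal (Real.exp (-(u i) ^ 2 / 4)) with hP
    simp only [hupd]
    rw [lintegral_const_mul _ (by fun_prop), lintegral_mul_const _ (by fun_prop), ← hG]
    have hin : ∀ s, inner ℝ (WithLp.toLp 2 (Function.update u k s)) v =
        s * v k + ∑ i ∈ Finset.univ.erase k, u i * v i := by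
      intro s
      rw [PiLp.inner_apply, ← Finset.add_sum_erase _ _ (Finset.mem_univ k)]
      congr 1
      · simp [mul_comm]
      · refine Finset.sum_congr rfl fun i hi => ?_
        simp [Function.update_of_ne (Finset.ne_of_mem_erase hi), mul_comm]
    calc _ ≤ ∫⁻ s, {s : ℝ | |s * v k + (∑ i ∈ Finset.univ.erase k, u i * v i + c)| ≤ r}.indicator
            (fun _ => P) s := by
          refine lintegral_mono fun s => ?_
          simp only [Set.indicator_apply, Set.mem_ofPred_eq, hin, add_assoc]
          split_ifs with h
          · simp only [Pi.one_apply, one_mul]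
            refine mul_le_of_le_one_left' ?_
            rw [ENNReal.ofReal_le_one, Real.exp_le_one_iff]
            have := sq_nonneg s
            linarith
          · simp
      _ ≤ P * (ENNReal.ofReal (2 / |v k|) * ENNReal.ofReal r) := by
          rw [lintegral_indicator_const (measurableSet_le (by fun_prop) measurable_const)]
          gcongr
          exact volume_setOf_abs_mul_add_le hk _ _
      _ = K * (G * P) := by
          rw [hK, ENNReal.div_eq_inv_mul]
          calc _ = (G⁻¹ * G) * (P * (ENNReal.ofReal (2 / |v k|) * ENNReal.ofReal r)) := by
                rw [ENNReal.inv_mul_cancel hG0 hGt, one_mul]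
            _ = _ := by ring
  refine key.trans ?_
  rw [lintegral_const_mul _ hWm, hK]
  exact le_of_eq (by ring)

theorem gaussMeasure_tieSlab_le {k : ℕ} {p : Fin k → EuclideanSpace ℝ (Fin d)}
    (hp : Function.Injective p) :
    ∃ C : ENNReal, C ≠ ⊤ ∧ ∀ w r, gaussMeasure d (tieSlab p w r) ≤ C * ENNReal.ofReal r := by
  have h : ∀ ik : {ik : Fin k × Fin k // ik.1 ≠ ik.2}, p ik.1.1 - p ik.1.2 ≠ 0 := fun ik =>
    sub_ne_zero.2 (hp.ne ik.2)
  choose C hC hCle using fun ik => gaussMeasure_slab_le (h ik)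
  refine ⟨∑ ik, C ik, ENNReal.sum_ne_top.2 fun ik _ => hC ik, fun w r => ?_⟩
  rw [Finset.sum_mul]
  exact (measure_iUnion_fintype_le _ _).trans (Finset.sum_le_sum fun ik _ => hCle ik _ _)

end Gaussian

/-- A measure with a measurable, bounded, everywhere positive density. -/
def HasBoundedPosDensity {E : Type*} [MeasureSpace E] (γ : Measure E) : Prop :=
  ∃ ρ : E → ℝ, Measurable ρ ∧ (∃ C, ∀ q, ρ q ≤ C) ∧ (∀ q, 0 < ρ q) ∧
    γ = volume.withDensity fun q => ENNReal.ofReal (ρ q)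

theorem HasBoundedPosDensity.volume_absolutelyContinuous {E : Type*} [MeasureSpace E]
    {γ : Measure E} (hγ : HasBoundedPosDensity γ) : (volume : Measure E) ≪ γ := by
  obtain ⟨ρ, hρm, -, hρ0, rfl⟩ := hγ
  exact withDensity_absolutelyContinuous' (by fun_prop)
    (ae_of_all _ fun q => by simpa using hρ0 q)

theorem HasBoundedPosDensity.absolutelyContinuous_volume {E : Type*} [MeasureSpace E]
    {γ : Measure E} (hγ : HasBoundedPosDensity γ) : γ ≪ volume := by
  obtain ⟨ρ, -, -, -, rfl⟩ := hγ
  exact withDensity_absolutelyContinuous _ _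

section Params

variable {n m : ℕ} (z δ : Param n m)

@[simp] theorem alpha_add : alpha (z + δ) = alpha z + alpha δ := rfl

@[simp] theorem beta_add : beta (z + δ) = beta z + beta δ := rfl

@[simp] theorem alpha_sub : alpha (z - δ) = alpha z - alpha δ := rfl

@[simp] theorem beta_sub : beta (z - δ) = beta z - beta δ := rfl

theorem abs_alpha_le_norm (i : Fin n) : |alpha z i| ≤ ‖z‖ := PiLp.norm_apply_le z (Sum.inl i)

theorem abs_beta_le_norm (j : Fin m) : |beta z j| ≤ ‖z‖ := PiLp.norm_apply_le z (Sum.inr j)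

end Params

/-! ### The exponential integrand: bounds, cells and perturbation. -/

section Integrand

variable {n m d : ℕ} (x : Fin n → EuclideanSpace ℝ (Fin d)) (y : Fin m → EuclideanSpace ℝ (Fin d))
  (z δ : Param n m) {γ : Measure (EuclideanSpace ℝ (Fin d) × EuclideanSpace ℝ (Fin d))}

theorem expIntegrand_pos (q) : 0 < expIntegrand x y z q := Real.exp_pos _

theorem measurable_expIntegrand : Measurable (expIntegrand x y z) := by
  have h1 := measurable_maxAffine x (alpha z)
  have h2 := measurable_maxAffine y (beta z)
  unfold expIntegrand
  fun_prop

theorem inner_sub_sq_le {E : Type*} [NormedAddCommGroup E] [InnerProductSpace ℝ E] {M : ℝ}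
    (u v : E) (hv : ‖v‖ ≤ M) : inner ℝ u v - ‖u‖ ^ 2 / 2 ≤ M ^ 2 - ‖u‖ ^ 2 / 4 := by
  have h1 := real_inner_le_norm u v
  have h2 := mul_le_mul_of_nonneg_left hv (norm_nonneg u)
  nlinarith [sq_nonneg (‖u‖ / 2 - M)]

/-- Half of each quadratic term absorbs the linear one. The parameter enters only through the sums
α_i + β_j, the quantities that superlevel sets control. -/
theorem expIntegrand_le [Nonempty (Fin n)] [Nonempty (Fin m)] :
    ∃ K : ℝ, 0 < K ∧ ∀ (T : ℝ) (z : Param n m), (∀ i j, alpha z i + beta z j ≤ T) → ∀ q,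
      expIntegrand x y z q ≤
        K * Real.exp T * (Real.exp (-‖q.1‖ ^ 2 / 4) * Real.exp (-‖q.2‖ ^ 2 / 4)) := by
  set M := ∑ i, ‖x i‖ + ∑ j, ‖y j‖ with hM
  refine ⟨Real.exp (2 * M ^ 2), Real.exp_pos _, fun T z hT q => ?_⟩
  obtain ⟨i, hi⟩ := exists_mem_laguerreCell x (alpha z) q.1
  obtain ⟨j, hj⟩ := exists_mem_laguerreCell y (beta z) q.2
  rw [laguerreCell, Set.mem_ofPred_eq] at hi hj
  have hxi : ‖x i‖ ≤ M := (Finset.single_le_sum (f := fun i => ‖x i‖)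
    (fun _ _ => norm_nonneg _) (Finset.mem_univ i)).trans
    (le_add_of_nonneg_right (Finset.sum_nonneg fun _ _ => norm_nonneg _))
  have hyj : ‖y j‖ ≤ M := (Finset.single_le_sum (f := fun j => ‖y j‖)
    (fun _ _ => norm_nonneg _) (Finset.mem_univ j)).trans
    (le_add_of_nonneg_left (Finset.sum_nonneg fun _ _ => norm_nonneg _))
  have h1 := inner_sub_sq_le q.1 (x i) hxi
  have h2 := inner_sub_sq_le q.2 (y j) hyj
  have h3 := hT i j
  rw [expIntegrand, hi, hj, ← Real.exp_add, ← Real.exp_add, ← Real.exp_add, Real.exp_le_exp]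
  linarith

theorem integrable_expIntegrand [Nonempty (Fin n)] [Nonempty (Fin m)] [IsFiniteMeasure γ] :
    Integrable (expIntegrand x y z) γ := by
  obtain ⟨K, hK, h⟩ := expIntegrand_le x y
  refine Integrable.of_bound (measurable_expIntegrand x y z).aestronglyMeasurable
    (K * Real.exp (‖z‖ + ‖z‖)) (ae_of_all _ fun q => ?_)
  rw [Real.norm_of_nonneg (expIntegrand_pos x y z q).le]
  refine (h _ z (fun i j => add_le_add ((le_abs_self _).trans (abs_alpha_le_norm z i))
    ((le_abs_self _).trans (abs_beta_le_norm z j))) q).trans ?_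
  refine mul_le_of_le_one_right (by positivity) (mul_le_one₀ ?_ (Real.exp_pos _).le ?_) <;>
  · rw [Real.exp_le_one_iff]
    have := sq_nonneg ‖q.1‖
    have := sq_nonneg ‖q.2‖
    linarith

theorem setLIntegral_expIntegrand_le [Nonempty (Fin n)] [Nonempty (Fin m)]
    (hγ : HasBoundedPosDensity γ) :
    ∃ C : ENNReal, C ≠ ⊤ ∧ ∀ (T : ℝ) (z : Param n m), (∀ i j, alpha z i + beta z j ≤ T) →
      ∀ s, MeasurableSet s → ∫⁻ q in s, ENNReal.ofReal (expIntegrand x y z q) ∂γ ≤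
        C * ENNReal.ofReal (Real.exp T) * ((gaussMeasure d).prod (gaussMeasure d)) s := by
  obtain ⟨K, hK, h⟩ := expIntegrand_le x y
  obtain ⟨ρ, hρm, ⟨C, hC⟩, hρ0, rfl⟩ := hγ
  refine ⟨ENNReal.ofReal C * ENNReal.ofReal K,
    ENNReal.mul_ne_top ENNReal.ofReal_ne_top ENNReal.ofReal_ne_top, fun T z hT s hs => ?_⟩
  have hm := measurable_expIntegrand x y z
  rw [setLIntegral_withDensity_eq_setLIntegral_mul _ (by fun_prop) (by fun_prop) hs, gaussMeasure,
    prod_withDensity (by fun_prop) (by fun_prop), withDensity_apply _ hs,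
    ← lintegral_const_mul _ (by fun_prop)]
  refine lintegral_mono fun q => ?_
  simp only [Pi.mul_apply]
  rw [mul_assoc, mul_assoc, ← ENNReal.ofReal_mul (Real.exp_pos _).le,
    ← ENNReal.ofReal_mul (Real.exp_pos _).le, ← ENNReal.ofReal_mul hK.le]
  gcongr
  · exact hC q
  · exact (h T z hT q).trans (le_of_eq (by ring))

/-- The pairs at which one of the two max-affine functions is within `r` of a tie. -/
def tieSet (r : ℝ) : Set (EuclideanSpace ℝ (Fin d) × EuclideanSpace ℝ (Fin d)) :=
  tieSlab x (alpha z) r ×ˢ Set.univ ∪ Set.univ ×ˢ tieSlab y (beta z) r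

theorem measurableSet_tieSet (r : ℝ) : MeasurableSet (tieSet x y z r) :=
  ((measurableSet_tieSlab _ _ _).prod MeasurableSet.univ).union
    (MeasurableSet.univ.prod (measurableSet_tieSlab _ _ _))

theorem setIntegral_tieSet_le [Nonempty (Fin n)] [Nonempty (Fin m)] [IsFiniteMeasure γ]
    (hx : Function.Injective x) (hy : Function.Injective y) (hγ : HasBoundedPosDensity γ) :
    ∃ C : ℝ, 0 ≤ C ∧ ∀ (T : ℝ) (z : Param n m), (∀ i j, alpha z i + beta z j ≤ T) →
      ∀ r, 0 ≤ r → ∫ q in tieSet x y z r, expIntegrand x y z q ∂γ ≤ C * Real.exp T * r := by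
  obtain ⟨C, hC, h⟩ := setLIntegral_expIntegrand_le x y hγ
  obtain ⟨Cx, hCx, hx⟩ := gaussMeasure_tieSlab_le hx
  obtain ⟨Cy, hCy, hy⟩ := gaussMeasure_tieSlab_le hy
  set G := gaussMeasure d Set.univ with hG
  have hGt : G ≠ ⊤ := measure_ne_top _ _
  have hD : C * (Cx * G + G * Cy) ≠ ⊤ := by finiteness
  refine ⟨(C * (Cx * G + G * Cy)).toReal, ENNReal.toReal_nonneg, fun T z hT r hr => ?_⟩
  rw [integral_eq_lintegral_of_nonneg_ae (ae_of_all _ fun q => (expIntegrand_pos x y z q).le)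
    (measurable_expIntegrand x y z).aestronglyMeasurable]
  refine ENNReal.toReal_le_of_le_ofReal (by positivity) ?_
  refine (h T z hT _ (measurableSet_tieSet x y z r)).trans ?_
  rw [ENNReal.ofReal_mul (by positivity), ENNReal.ofReal_mul ENNReal.toReal_nonneg,
    ENNReal.ofReal_toReal hD]
  calc _ ≤ C * ENNReal.ofReal (Real.exp T) *
        (Cx * ENNReal.ofReal r * G + G * (Cy * ENNReal.ofReal r)) := by
        gcongr
        refine (measure_union_le _ _).trans ?_
        rw [Measure.prod_prod, Measure.prod_prod, ← hG]
        gcongr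
        · exact hx _ _
        · exact hy _ _
    _ = _ := by ring

theorem integral_expIntegrand_le [Nonempty (Fin n)] [Nonempty (Fin m)]
    (hγ : HasBoundedPosDensity γ) :
    ∃ C : ℝ, 0 ≤ C ∧ ∀ (T : ℝ) (z : Param n m), (∀ i j, alpha z i + beta z j ≤ T) →
      ∫ q, expIntegrand x y z q ∂γ ≤ C * Real.exp T := by
  obtain ⟨C, hC, h⟩ := setLIntegral_expIntegrand_le x y hγ
  have hD : C * ((gaussMeasure d).prod (gaussMeasure d)) Set.univ ≠ ⊤ := by finiteness
  refine ⟨_, ENNReal.toReal_nonneg (a := C * ((gaussMeasure d).prod (gaussMeasure d)) Set.univ),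
    fun T z hT => ?_⟩
  rw [integral_eq_lintegral_of_nonneg_ae (ae_of_all _ fun q => (expIntegrand_pos x y z q).le)
    (measurable_expIntegrand x y z).aestronglyMeasurable]
  refine ENNReal.toReal_le_of_le_ofReal (by positivity) ?_
  have := h T z hT _ MeasurableSet.univ
  rw [setLIntegral_univ] at this
  refine this.trans ?_
  rw [ENNReal.ofReal_mul ENNReal.toReal_nonneg, ENNReal.ofReal_toReal hD]
  exact le_of_eq (by ring)

/-- The case `r = 0` of the linear bound: a positive integrand with zero integral lives on a null
set. -/
theorem measure_tieSet_zero [Nonempty (Fin n)] [Nonempty (Fin m)] [IsFiniteMeasure γ]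
    (hx : Function.Injective x) (hy : Function.Injective y) (hγ : HasBoundedPosDensity γ) :
    γ (tieSet x y z 0) = 0 := by
  obtain ⟨C, hC, h⟩ := setIntegral_tieSet_le x y hx hy hγ
  have h0 := h (‖z‖ + ‖z‖) z (fun i j => add_le_add ((le_abs_self _).trans (abs_alpha_le_norm z i))
    ((le_abs_self _).trans (abs_beta_le_norm z j))) 0 le_rfl
  rw [mul_zero] at h0
  by_contra hne
  refine absurd h0 (not_le.2 ?_)
  rw [setIntegral_pos_iff_support_of_nonneg_ae (ae_of_all _ fun q => (expIntegrand_pos x y z q).le)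
    (integrable_expIntegrand x y z).integrableOn]
  have : Function.support (expIntegrand x y z) = Set.univ :=
    Set.eq_univ_of_forall fun q => (expIntegrand_pos x y z q).ne'
  rw [this, Set.univ_inter]
  exact pos_iff_ne_zero.2 hne

/-- The product cell `A_i(α) × B_j(β)`. -/
def prodCell (ij : Fin n × Fin m) : Set (EuclideanSpace ℝ (Fin d) × EuclideanSpace ℝ (Fin d)) :=
  laguerreCell x (alpha z) ij.1 ×ˢ laguerreCell y (beta z) ij.2

theorem measurableSet_prodCell (ij : Fin n × Fin m) : MeasurableSet (prodCell x y z ij) :=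
  (measurableSet_laguerreCell _ _ _).prod (measurableSet_laguerreCell _ _ _)

theorem aedisjoint_prodCell [Nonempty (Fin n)] [Nonempty (Fin m)] [IsFiniteMeasure γ]
    (hx : Function.Injective x) (hy : Function.Injective y) (hγ : HasBoundedPosDensity γ) :
    Pairwise (Function.onFun (AEDisjoint γ) (prodCell x y z)) := by
  rintro ⟨i, j⟩ ⟨i', j'⟩ hne
  refine measure_mono_null ?_ (measure_tieSet_zero x y z hx hy hγ)
  rintro q ⟨⟨h1, h2⟩, h3, h4⟩
  by_cases hi : i = i'
  · have hj : j ≠ j' := fun hj => hne (by rw [hi, hj])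
    exact Or.inr ⟨trivial, laguerreCell_inter_subset_tieSlab y _ hj ⟨h2, h4⟩⟩
  · exact Or.inl ⟨laguerreCell_inter_subset_tieSlab x _ hi ⟨h1, h3⟩, trivial⟩

theorem integral_eq_sum_prodCell [Nonempty (Fin n)] [Nonempty (Fin m)] [IsFiniteMeasure γ]
    (hx : Function.Injective x) (hy : Function.Injective y) (hγ : HasBoundedPosDensity γ)
    {f : EuclideanSpace ℝ (Fin d) × EuclideanSpace ℝ (Fin d) → ℝ} (hf : Integrable f γ) :
    ∫ q, f q ∂γ = ∑ i, ∑ j, ∫ q in prodCell x y z (i, j), f q ∂γ := by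
  have hU : ⋃ ij, prodCell x y z ij = Set.univ := Set.eq_univ_of_forall fun q => by
    obtain ⟨i, hi⟩ := exists_mem_laguerreCell x (alpha z) q.1
    obtain ⟨j, hj⟩ := exists_mem_laguerreCell y (beta z) q.2
    exact Set.mem_iUnion.2 ⟨(i, j), hi, hj⟩
  rw [← setIntegral_univ, ← hU, integral_iUnion_ae
    (fun ij => (measurableSet_prodCell x y z ij).nullMeasurableSet)
    (aedisjoint_prodCell x y z hx hy hγ) hf.integrableOn, tsum_fintype, Fintype.sum_prod_type]

theorem setIntegral_laguerreCell_prod_univ [Nonempty (Fin n)] [Nonempty (Fin m)]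
    [IsFiniteMeasure γ]
    (hx : Function.Injective x) (hy : Function.Injective y) (hγ : HasBoundedPosDensity γ)
    {f : EuclideanSpace ℝ (Fin d) × EuclideanSpace ℝ (Fin d) → ℝ} (hf : Integrable f γ)
    (i : Fin n) :
    ∫ q in laguerreCell x (alpha z) i ×ˢ Set.univ, f q ∂γ =
      ∑ j, ∫ q in prodCell x y z (i, j), f q ∂γ := by
  have hU : laguerreCell x (alpha z) i ×ˢ Set.univ = ⋃ j, prodCell x y z (i, j) := by
    ext q
    simp only [prodCell, Set.mem_prod, Set.mem_univ, and_true, Set.mem_iUnion, exists_and_left]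
    exact ⟨fun h => ⟨h, exists_mem_laguerreCell y (beta z) q.2⟩, fun h => h.1⟩
  rw [hU, integral_iUnion_ae (fun j => (measurableSet_prodCell x y z (i, j)).nullMeasurableSet)
    (fun j j' hj => aedisjoint_prodCell x y z hx hy hγ fun h => hj (Prod.ext_iff.1 h).2)
    hf.integrableOn, tsum_fintype]

theorem setIntegral_univ_prod_laguerreCell [Nonempty (Fin n)] [Nonempty (Fin m)]
    [IsFiniteMeasure γ]
    (hx : Function.Injective x) (hy : Function.Injective y) (hγ : HasBoundedPosDensity γ)
    {f : EuclideanSpace ℝ (Fin d) × EuclideanSpace ℝ (Fin d) → ℝ} (hf : Integrable f γ)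
    (j : Fin m) :
    ∫ q in Set.univ ×ˢ laguerreCell y (beta z) j, f q ∂γ =
      ∑ i, ∫ q in prodCell x y z (i, j), f q ∂γ := by
  have hU : Set.univ ×ˢ laguerreCell y (beta z) j = ⋃ i, prodCell x y z (i, j) := by
    ext q
    simp only [prodCell, Set.mem_prod, Set.mem_univ, true_and, Set.mem_iUnion, exists_and_right]
    exact ⟨fun h => ⟨exists_mem_laguerreCell x (alpha z) q.1, h⟩, fun h => h.2⟩
  rw [hU, integral_iUnion_ae (fun i => (measurableSet_prodCell x y z (i, j)).nullMeasurableSet)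
    (fun i i' hi => aedisjoint_prodCell x y z hx hy hγ fun h => hi (Prod.ext_iff.1 h).1)
    hf.integrableOn, tsum_fintype]

/-- The integral of the integrand over a product cell. -/
def cellMass (γ : Measure (EuclideanSpace ℝ (Fin d) × EuclideanSpace ℝ (Fin d)))
    (i : Fin n) (j : Fin m) : ℝ :=
  ∫ q in prodCell x y z (i, j), expIntegrand x y z q ∂γ

theorem cellMass_nonneg (i : Fin n) (j : Fin m) : 0 ≤ cellMass x y z γ i j :=
  setIntegral_nonneg (measurableSet_prodCell x y z _) fun q _ => (expIntegrand_pos x y z q).le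

theorem expIntegrand_mul_exp_le {q} {i : Fin n} {j : Fin m} (hq : q ∈ prodCell x y z (i, j)) :
    expIntegrand x y z q * Real.exp (alpha δ i + beta δ j) ≤ expIntegrand x y (z + δ) q := by
  have h1 := add_le_maxAffine_add x (alpha z) (alpha δ) q.1 hq.1
  have h2 := add_le_maxAffine_add y (beta z) (beta δ) q.2 hq.2
  rw [expIntegrand, expIntegrand, ← Real.exp_add, Real.exp_le_exp, alpha_add, beta_add]
  linarith

theorem sum_cellMass_mul_exp_le [Nonempty (Fin n)] [Nonempty (Fin m)] [IsFiniteMeasure γ]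
    (hx : Function.Injective x) (hy : Function.Injective y) (hγ : HasBoundedPosDensity γ) :
    ∑ i, ∑ j, cellMass x y z γ i j * Real.exp (alpha δ i + beta δ j) ≤
      ∫ q, expIntegrand x y (z + δ) q ∂γ := by
  rw [integral_eq_sum_prodCell x y z hx hy hγ (integrable_expIntegrand x y (z + δ))]
  refine Finset.sum_le_sum fun i _ => Finset.sum_le_sum fun j _ => ?_
  rw [cellMass, ← integral_mul_const]
  exact setIntegral_mono_on ((integrable_expIntegrand x y z).mul_const _).integrableOn
    (integrable_expIntegrand x y (z + δ)).integrableOn (measurableSet_prodCell x y z _)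
    fun q hq => expIntegrand_mul_exp_le x y z δ hq

/-- Off the tie set the change is exactly the factor exp D_ij, with a second-order error. On it the
error is only first order, but that set is itself small. -/
theorem expIntegrand_add_le [Nonempty (Fin n)] [Nonempty (Fin m)] (hδ : ‖δ‖ ≤ 1 / 2)
    {q} {i : Fin n} {j : Fin m} (hq : q ∈ prodCell x y z (i, j)) :
    expIntegrand x y (z + δ) q ≤ expIntegrand x y z q * (1 + (alpha δ i + beta δ j)) +
      (4 * ‖δ‖ ^ 2 * expIntegrand x y z q +
        4 * ‖δ‖ * (tieSet x y z (2 * ‖δ‖)).indicator (expIntegrand x y z) q) := by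
  have hE := expIntegrand_pos x y z q
  have hr := norm_nonneg δ
  have hi := abs_le.1 (abs_alpha_le_norm δ i)
  have hj := abs_le.1 (abs_beta_le_norm δ j)
  -- The bound |exp D - 1 - D| ≤ D² needs |D| ≤ 1, whence `‖δ‖ ≤ 1 / 2`.
  have hexp : ∀ D, |D| ≤ 2 * ‖δ‖ → Real.exp D ≤ 1 + D + 4 * ‖δ‖ ^ 2 := by
    intro D hD
    have h1 := (abs_le.1 (Real.abs_exp_sub_one_sub_id_le (hD.trans (by linarith)))).2
    have h2 : D ^ 2 ≤ (2 * ‖δ‖) ^ 2 := sq_le_sq' (abs_le.1 hD).1 (abs_le.1 hD).2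
    linarith
  have hadd : ∀ D, maxAffine x (alpha (z + δ)) q.1 + maxAffine y (beta (z + δ)) q.2 ≤
      maxAffine x (alpha z) q.1 + maxAffine y (beta z) q.2 + D →
      expIntegrand x y (z + δ) q ≤ expIntegrand x y z q * Real.exp D := by
    intro D hD
    rw [expIntegrand, expIntegrand, ← Real.exp_add, Real.exp_le_exp]
    linarith
  by_cases hN : q ∈ tieSet x y z (2 * ‖δ‖)
  · rw [Set.indicator_of_mem hN]
    have h1 := maxAffine_add_le x (alpha z) (alpha δ) q.1
      fun i => (le_abs_self _).trans (abs_alpha_le_norm δ i)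
    have h2 := maxAffine_add_le y (beta z) (beta δ) q.2
      fun j => (le_abs_self _).trans (abs_beta_le_norm δ j)
    have h3 := hadd (2 * ‖δ‖) (by rw [alpha_add, beta_add]; linarith)
    have h4 := hexp (2 * ‖δ‖) (by rw [abs_of_nonneg (by linarith)])
    refine h3.trans ?_
    -- Since D_ij ≥ -2‖δ‖, replacing 2‖δ‖ by D_ij costs at most 4‖δ‖.
    have h5 : Real.exp (2 * ‖δ‖) ≤ 1 + (alpha δ i + beta δ j) + 4 * ‖δ‖ ^ 2 + 4 * ‖δ‖ := by
      linarith
    exact (mul_le_mul_of_nonneg_left h5 hE.le).trans (le_of_eq (by ring))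
  · rw [Set.indicator_of_notMem hN]
    have hN1 : q.1 ∉ tieSlab x (alpha z) (2 * ‖δ‖) := fun h => hN (Or.inl ⟨h, trivial⟩)
    have hN2 : q.2 ∉ tieSlab y (beta z) (2 * ‖δ‖) := fun h => hN (Or.inr ⟨trivial, h⟩)
    have h1 := maxAffine_add_eq_of_notMem_tieSlab x _ (alpha δ) q.1 (abs_alpha_le_norm δ) hq.1 hN1
    have h2 := maxAffine_add_eq_of_notMem_tieSlab y _ (beta δ) q.2 (abs_beta_le_norm δ) hq.2 hN2
    have h3 := hadd (alpha δ i + beta δ j) (by rw [alpha_add, beta_add, h1, h2]; linarith)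
    have h4 := hexp (alpha δ i + beta δ j) (abs_le.2 ⟨by linarith, by linarith⟩)
    exact h3.trans ((mul_le_mul_of_nonneg_left h4 hE.le).trans (le_of_eq (by ring)))

theorem integral_expIntegrand_add_le [Nonempty (Fin n)] [Nonempty (Fin m)] [IsFiniteMeasure γ]
    (hx : Function.Injective x) (hy : Function.Injective y) (hγ : HasBoundedPosDensity γ) :
    ∃ C : ℝ, 0 ≤ C ∧ ∀ (T : ℝ) (z : Param n m), (∀ i j, alpha z i + beta z j ≤ T) →
      ∀ δ : Param n m, ‖δ‖ ≤ 1 / 2 → ∫ q, expIntegrand x y (z + δ) q ∂γ ≤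
        ∑ i, ∑ j, cellMass x y z γ i j * (1 + (alpha δ i + beta δ j)) +
          C * Real.exp T * ‖δ‖ ^ 2 := by
  obtain ⟨C₁, hC₁, h₁⟩ := integral_expIntegrand_le x y hγ
  obtain ⟨C₂, hC₂, h₂⟩ := setIntegral_tieSet_le x y hx hy hγ
  refine ⟨4 * C₁ + 8 * C₂, by positivity, fun T z hT δ hδ => ?_⟩
  have hI := integrable_expIntegrand (γ := γ) x y z
  have hN := measurableSet_tieSet x y z (2 * ‖δ‖)
  set H := fun q => 4 * ‖δ‖ ^ 2 * expIntegrand x y z q +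
        4 * ‖δ‖ * (tieSet x y z (2 * ‖δ‖)).indicator (expIntegrand x y z) q with hH
  have hHI : Integrable H γ := (hI.const_mul _).add ((hI.indicator hN).const_mul _)
  have hHle : ∫ q, H q ∂γ ≤ (4 * C₁ + 8 * C₂) * Real.exp T * ‖δ‖ ^ 2 := by
    rw [hH, integral_add (hI.const_mul _) ((hI.indicator hN).const_mul _), integral_const_mul,
      integral_const_mul, integral_indicator hN]
    have := h₁ T z hT
    have := h₂ T z hT (2 * ‖δ‖) (by positivity)
    calc _ ≤ 4 * ‖δ‖ ^ 2 * (C₁ * Real.exp T) + 4 * ‖δ‖ * (C₂ * Real.exp T * (2 * ‖δ‖)) := by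
          gcongr
      _ = _ := by ring
  rw [integral_eq_sum_prodCell x y z hx hy hγ (integrable_expIntegrand x y (z + δ))]
  refine le_trans ?_ (add_le_add_right hHle _)
  rw [integral_eq_sum_prodCell x y z hx hy hγ hHI, ← Finset.sum_add_distrib]
  refine Finset.sum_le_sum fun i _ => ?_
  rw [← Finset.sum_add_distrib]
  refine Finset.sum_le_sum fun j _ => ?_
  rw [cellMass, ← integral_mul_const, ← integral_add (hI.mul_const _).integrableOn hHI.integrableOn]
  exact setIntegral_mono_on (integrable_expIntegrand x y (z + δ)).integrableOn
    ((hI.mul_const _).add hHI).integrableOn (measurableSet_prodCell x y z _)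
    fun q hq => expIntegrand_add_le x y z δ hδ hq

end Integrand

/-! ### A scalar inequality and an abstract linear rate. -/

/-- For D ≥ -2, square exp(D/2) ≥ 1 + D/2; for D < -2, positivity of exp suffices. -/
theorem sq_div_le_exp_sub_one_sub_id (D : ℝ) : D ^ 2 / (4 + 2 * |D|) ≤ Real.exp D - 1 - D := by
  have h0 := abs_nonneg D
  rw [div_le_iff₀ (by linarith)]
  rcases le_or_gt (-2) D with h | h
  · have h1 := Real.add_one_le_exp (D / 2)
    have h2 : (D / 2 + 1) ^ 2 ≤ Real.exp (D / 2) ^ 2 := pow_le_pow_left₀ (by linarith) h1 2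
    rw [← Real.exp_nat_mul] at h2
    have h3 : ((2 : ℕ) : ℝ) * (D / 2) = D := by push_cast; ring
    rw [h3] at h2
    nlinarith [mul_nonneg (sq_nonneg D) h0]
  · rw [abs_of_neg (by linarith)]
    nlinarith [Real.exp_pos D]

/-- Gradient ascent converges linearly under a local smoothness condition, a gradient domination
condition and quadratic growth, all required on a superlevel set only. -/
theorem gradientAscent_linear_rate {E : Type*} [NormedAddCommGroup E] [InnerProductSpace ℝ E]
    {U N : E → ℝ} {G : E → E} {u₀ Us L c C : ℝ} (hL : 0 ≤ L) (hc : 0 < c) (hC : 0 < C)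
    (hmax : ∀ z, U z ≤ Us)
    (hsmooth : ∀ z, u₀ ≤ U z → ∀ δ, ‖δ‖ ≤ 1 / 2 →
      U z + inner ℝ (G z) δ - L * ‖δ‖ ^ 2 ≤ U (z + δ))
    (hdom : ∀ z, u₀ ≤ U z → Us - U z ≤ C * ‖G z‖ * N z)
    (hgrowth : ∀ z, u₀ ≤ U z → c * N z ^ 2 ≤ Us - U z) :
    ∃ η₀ : ℝ, 0 < η₀ ∧ ∀ η, 0 < η → η < η₀ → ∃ θ ∈ Set.Ioo (0 : ℝ) 1, ∀ s : ℕ → E,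
      u₀ ≤ U (s 0) → (∀ t, s (t + 1) = s t + η • G (s t)) →
      ∃ D : ℝ, ∀ t, N (s t) ≤ D * θ ^ t := by
  -- A move of length 1/2 along the gradient cannot exceed `Us`, so ‖G‖/2 ≤ Us - u₀ + L/4.
  set B := |L / 2 + 2 * (Us - u₀)| + 1 with hB
  have hB0 : 0 < B := by positivity
  have hGB : ∀ z, u₀ ≤ U z → ‖G z‖ ≤ B := by
    intro z hz
    rcases eq_or_ne (G z) 0 with h0 | h0
    · rw [h0, norm_zero]; exact hB0.le
    have hg : ‖G z‖ ≠ 0 := norm_ne_zero_iff.2 h0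
    have hn : ‖(1 / 2 * ‖G z‖⁻¹) • G z‖ = 1 / 2 := by
      rw [norm_smul, Real.norm_of_nonneg (by positivity)]
      field_simp
    have h1 := hsmooth z hz _ hn.le
    have h2 := hmax (z + (1 / 2 * ‖G z‖⁻¹) • G z)
    rw [hn, inner_smul_right, real_inner_self_eq_norm_sq] at h1
    have h3 : 1 / 2 * ‖G z‖⁻¹ * ‖G z‖ ^ 2 = ‖G z‖ / 2 := by field_simp
    rw [h3] at h1
    have := le_abs_self (L / 2 + 2 * (Us - u₀))
    linarith
  -- The three bounds make the quadratic loss at most half the gain, keep the step within radius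
  -- 1/2, and make `q` positive.
  refine ⟨min (1 / (2 * (L + 1))) (min (1 / (2 * B)) (C ^ 2 / c)), by positivity,
    fun η hη hlt => ?_⟩
  obtain ⟨hη1, hη2, hη3⟩ : η < 1 / (2 * (L + 1)) ∧ η < 1 / (2 * B) ∧ η < C ^ 2 / c := by
    simpa using hlt
  rw [lt_div_iff₀ (by positivity)] at hη1 hη2 hη3
  set q := 1 - η * c / (2 * C ^ 2) with hq
  have hq1 : q < 1 := by
    have : 0 < η * c / (2 * C ^ 2) := by positivity
    linarith
  have hq0 : 0 < q := by
    have : η * c / (2 * C ^ 2) < 1 := by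
      rw [div_lt_one (by positivity)]
      nlinarith [sq_nonneg C]
    linarith
  have hstep : ∀ z, u₀ ≤ U z → U z ≤ U (z + η • G z) ∧ Us - U (z + η • G z) ≤ q * (Us - U z) := by
    intro z hz
    have hg := hGB z hz
    have hg0 := norm_nonneg (G z)
    have hn : ‖η • G z‖ = η * ‖G z‖ := by rw [norm_smul, Real.norm_of_nonneg hη.le]
    have h1 := hsmooth z hz (η • G z) (by rw [hn]; nlinarith)
    rw [hn, inner_smul_right, real_inner_self_eq_norm_sq] at h1
    have h2 : L * η ≤ 1 / 2 := by nlinarith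
    have h3 : L * (η * ‖G z‖) ^ 2 ≤ η / 2 * ‖G z‖ ^ 2 := by
      calc L * (η * ‖G z‖) ^ 2 = (L * η) * (η * ‖G z‖ ^ 2) := by ring
        _ ≤ 1 / 2 * (η * ‖G z‖ ^ 2) := by gcongr
        _ = _ := by ring
    have hdesc : U z + η / 2 * ‖G z‖ ^ 2 ≤ U (z + η • G z) := by linarith
    -- Polyak–Łojasiewicz: square the gradient domination, bound `N z ^ 2` by quadratic growth, and
    -- cancel one factor of the gap.
    have hpl : c * (Us - U z) ≤ C ^ 2 * ‖G z‖ ^ 2 := by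
      have he0 : 0 ≤ Us - U z := sub_nonneg.2 (hmax z)
      rcases he0.eq_or_lt with he | he
      · rw [← he, mul_zero]; positivity
      have hd := hdom z hz
      have hgr := hgrowth z hz
      have hsq : (Us - U z) ^ 2 ≤ (C * ‖G z‖ * N z) ^ 2 := pow_le_pow_left₀ he0 hd 2
      have : (c * (Us - U z)) * (Us - U z) ≤ (C ^ 2 * ‖G z‖ ^ 2) * (Us - U z) := by
        calc (c * (Us - U z)) * (Us - U z) = c * (Us - U z) ^ 2 := by ring
          _ ≤ c * (C * ‖G z‖ * N z) ^ 2 := by gcongr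
          _ = (C ^ 2 * ‖G z‖ ^ 2) * (c * N z ^ 2) := by ring
          _ ≤ _ := by gcongr
      exact le_of_mul_le_mul_right this he
    refine ⟨(le_add_of_nonneg_right (by positivity)).trans hdesc, ?_⟩
    have h4 : η * c / (2 * C ^ 2) * (Us - U z) ≤ η / 2 * ‖G z‖ ^ 2 := by
      rw [div_mul_eq_mul_div, div_le_iff₀ (by positivity)]
      nlinarith
    rw [hq, sub_mul, one_mul]
    linarith
  -- The gap contracts by `q` and controls the square of `N`, hence the root.
  refine ⟨√q, ⟨Real.sqrt_pos.2 hq0, by rw [Real.sqrt_lt' one_pos]; simpa using hq1⟩,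
    fun s hs0 hs => ?_⟩
  have hmain : ∀ t, u₀ ≤ U (s t) ∧ Us - U (s t) ≤ q ^ t * (Us - U (s 0)) := by
    intro t
    induction t with
    | zero => simpa using hs0
    | succ t ih =>
      have h := hstep (s t) ih.1
      rw [← hs t] at h
      refine ⟨ih.1.trans h.1, h.2.trans ?_⟩
      rw [pow_succ', mul_assoc]
      exact mul_le_mul_of_nonneg_left ih.2 hq0.le
  have he0 : 0 ≤ (Us - U (s 0)) / c := div_nonneg (sub_nonneg.2 (hmax _)) hc.le
  refine ⟨√((Us - U (s 0)) / c), fun t => ?_⟩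
  refine abs_le_of_sq_le_sq' ?_ (by positivity) |>.2
  rw [mul_pow, Real.sq_sqrt he0, ← pow_mul, mul_comm t 2, pow_mul, Real.sq_sqrt hq0.le,
    div_mul_eq_mul_div, le_div_iff₀ hc, mul_comm, mul_comm (Us - _)]
  exact (hgrowth _ (hmain t).1).trans (hmain t).2

/-! ### Geometry modulo shifts. -/

section Oplus

variable {n m : ℕ}

/-- The direction `(r 𝟏, -r 𝟏)` along which the dual objective is constant. -/
def oplusShift (n m : ℕ) (r : ℝ) : Param n m :=
  WithLp.toLp 2 (Sum.elim (fun _ => r) (fun _ => -r))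

@[simp] theorem alpha_oplusShift (r : ℝ) (i : Fin n) : alpha (oplusShift n m r) i = r := rfl

@[simp] theorem beta_oplusShift (r : ℝ) (j : Fin m) : beta (oplusShift n m r) j = -r := rfl

theorem l2Oplus_nonneg (w : Param n m) : 0 ≤ l2Oplus w := Real.sqrt_nonneg _

theorem l2Oplus_sq (w : Param n m) : l2Oplus w ^ 2 = ∑ i, ∑ j, (alpha w i + beta w j) ^ 2 :=
  Real.sq_sqrt (Finset.sum_nonneg fun _ _ => Finset.sum_nonneg fun _ _ => sq_nonneg _)

theorem abs_alpha_add_beta_le_l2Oplus (w : Param n m) (i : Fin n) (j : Fin m) :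
    |alpha w i + beta w j| ≤ l2Oplus w := by
  refine Real.abs_le_sqrt ?_
  refine le_trans ?_ (Finset.single_le_sum (f := fun i => ∑ j, (alpha w i + beta w j) ^ 2)
    (fun _ _ => Finset.sum_nonneg fun _ _ => sq_nonneg _) (Finset.mem_univ i))
  exact Finset.single_le_sum (f := fun j => (alpha w i + beta w j) ^ 2)
    (fun _ _ => sq_nonneg _) (Finset.mem_univ j)

/-- After the shift, each α-entry is a difference of two of the bounded sums and each β-entry is one
such sum. -/
theorem norm_sub_oplusShift_le (w : Param n m) {M : ℝ} (hM : 0 ≤ M)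
    (h : ∀ i j, |alpha w i + beta w j| ≤ M) (i₀ : Fin n) (j₀ : Fin m) :
    ‖w - oplusShift n m (alpha w i₀)‖ ≤ √(n + m) * 2 * M := by
  rw [EuclideanSpace.norm_eq, mul_assoc, ← Real.sqrt_sq (by positivity : 0 ≤ 2 * M),
    ← Real.sqrt_mul (by positivity)]
  refine Real.sqrt_le_sqrt ?_
  have hle : ∀ k, ‖(w - oplusShift n m (alpha w i₀)) k‖ ^ 2 ≤ (2 * M) ^ 2 := by
    intro k
    refine pow_le_pow_left₀ (norm_nonneg _) ?_ 2
    rw [Real.norm_eq_abs]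
    rcases k with i | j
    · change |alpha w i - alpha w i₀| ≤ _
      have h1 := abs_le.1 (h i j₀)
      have h2 := abs_le.1 (h i₀ j₀)
      exact abs_le.2 ⟨by linarith, by linarith⟩
    · change |beta w j - -alpha w i₀| ≤ _
      have h1 := abs_le.1 (h i₀ j)
      exact abs_le.2 ⟨by linarith, by linarith⟩
  refine (Finset.sum_le_card_nsmul _ _ _ fun k _ => hle k).trans (le_of_eq ?_)
  simp [nsmul_eq_mul]

end Oplus

/-! ### The dual objective: concavity, maximizers, growth. -/

section Dual

variable {n m d : ℕ} {a : Fin n → ℝ} {b : Fin m → ℝ}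
  {x : Fin n → EuclideanSpace ℝ (Fin d)} {y : Fin m → EuclideanSpace ℝ (Fin d)}
  {γ : Measure (EuclideanSpace ℝ (Fin d) × EuclideanSpace ℝ (Fin d))}

theorem inner_explicitGradient [Nonempty (Fin n)] [Nonempty (Fin m)] [IsFiniteMeasure γ]
    (hx : Function.Injective x) (hy : Function.Injective y) (hγ : HasBoundedPosDensity γ)
    (z δ : Param n m) :
    inner ℝ (explicitGradient a b x y γ z) δ = ∑ i, a i * alpha δ i + ∑ j, b j * beta δ j -
      ∑ i, ∑ j, cellMass x y z γ i j * (alpha δ i + beta δ j) := by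
  have hI := integrable_expIntegrand (γ := γ) x y z
  rw [PiLp.inner_apply, Fintype.sum_sum_type]
  have h1 : ∀ i, inner ℝ (explicitGradient a b x y γ z (Sum.inl i)) (δ (Sum.inl i)) =
      a i * alpha δ i - ∑ j, cellMass x y z γ i j * alpha δ i := by
    intro i
    rw [← Finset.sum_mul, ← sub_mul]
    simp only [cellMass]
    rw [← setIntegral_laguerreCell_prod_univ x y z hx hy hγ hI]
    simp [explicitGradient, alpha, mul_comm]
  have h2 : ∀ j, inner ℝ (explicitGradient a b x y γ z (Sum.inr j)) (δ (Sum.inr j)) =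
      b j * beta δ j - ∑ i, cellMass x y z γ i j * beta δ j := by
    intro j
    rw [← Finset.sum_mul, ← sub_mul]
    simp only [cellMass]
    rw [← setIntegral_univ_prod_laguerreCell x y z hx hy hγ hI]
    simp [explicitGradient, beta, mul_comm]
  simp only [h1, h2, mul_add, Finset.sum_sub_distrib, Finset.sum_add_distrib]
  rw [Finset.sum_comm (f := fun (i : Fin n) (j : Fin m) => cellMass x y z γ i j * beta δ j)]
  ring

/-- An exact identity: all of the remainder is the integral minus its first-order model. -/
theorem dualObjective_add [Nonempty (Fin n)] [Nonempty (Fin m)] [IsFiniteMeasure γ]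
    (hx : Function.Injective x) (hy : Function.Injective y) (hγ : HasBoundedPosDensity γ)
    (z δ : Param n m) :
    dualObjective a b x y γ (z + δ) = dualObjective a b x y γ z +
      inner ℝ (explicitGradient a b x y γ z) δ +
      ∑ i, ∑ j, cellMass x y z γ i j * (1 + (alpha δ i + beta δ j)) -
      ∫ q, expIntegrand x y (z + δ) q ∂γ := by
  rw [inner_explicitGradient hx hy hγ, dualObjective, dualObjective,
    integral_eq_sum_prodCell x y z hx hy hγ (integrable_expIntegrand x y z)]
  simp only [alpha_add, beta_add, Pi.add_apply, mul_add, Finset.sum_add_distrib, mul_one, cellMass]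
  ring

theorem le_dualObjective_add [Nonempty (Fin n)] [Nonempty (Fin m)] [IsFiniteMeasure γ]
    (hx : Function.Injective x) (hy : Function.Injective y) (hγ : HasBoundedPosDensity γ)
    (a : Fin n → ℝ) (b : Fin m → ℝ) (T : ℝ) :
    ∃ L : ℝ, 0 ≤ L ∧ ∀ z : Param n m, (∀ i j, alpha z i + beta z j ≤ T) →
      ∀ δ : Param n m, ‖δ‖ ≤ 1 / 2 → dualObjective a b x y γ z +
        inner ℝ (explicitGradient a b x y γ z) δ - L * ‖δ‖ ^ 2 ≤
        dualObjective a b x y γ (z + δ) := by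
  obtain ⟨C, hC, h⟩ := integral_expIntegrand_add_le x y hx hy hγ
  refine ⟨C * Real.exp T, by positivity, fun z hz δ hδ => ?_⟩
  have := h T z hz δ hδ
  rw [dualObjective_add hx hy hγ]
  linarith

theorem dualObjective_add_le [Nonempty (Fin n)] [Nonempty (Fin m)] [IsFiniteMeasure γ]
    (hx : Function.Injective x) (hy : Function.Injective y) (hγ : HasBoundedPosDensity γ)
    (z δ : Param n m) :
    dualObjective a b x y γ (z + δ) ≤ dualObjective a b x y γ z +
      inner ℝ (explicitGradient a b x y γ z) δ -
      ∑ i, ∑ j, cellMass x y z γ i j *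
        ((alpha δ i + beta δ j) ^ 2 / (4 + 2 * |alpha δ i + beta δ j|)) := by
  have h := sum_cellMass_mul_exp_le x y z δ hx hy hγ
  rw [dualObjective_add hx hy hγ]
  have h2 : ∑ i, ∑ j, cellMass x y z γ i j * (1 + (alpha δ i + beta δ j)) +
      ∑ i, ∑ j, cellMass x y z γ i j *
        ((alpha δ i + beta δ j) ^ 2 / (4 + 2 * |alpha δ i + beta δ j|)) ≤
      ∑ i, ∑ j, cellMass x y z γ i j * Real.exp (alpha δ i + beta δ j) := by
    rw [← Finset.sum_add_distrib]
    refine Finset.sum_le_sum fun i _ => ?_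
    rw [← Finset.sum_add_distrib]
    refine Finset.sum_le_sum fun j _ => ?_
    rw [← mul_add]
    refine mul_le_mul_of_nonneg_left ?_ (cellMass_nonneg x y z i j)
    have := sq_div_le_exp_sub_one_sub_id (alpha δ i + beta δ j)
    linarith
  linarith

theorem dualObjective_add_le_inner [Nonempty (Fin n)] [Nonempty (Fin m)] [IsFiniteMeasure γ]
    (hx : Function.Injective x) (hy : Function.Injective y) (hγ : HasBoundedPosDensity γ)
    (z δ : Param n m) :
    dualObjective a b x y γ (z + δ) ≤ dualObjective a b x y γ z +
      inner ℝ (explicitGradient a b x y γ z) δ := by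
  refine (dualObjective_add_le hx hy hγ z δ).trans (sub_le_self _ ?_)
  refine Finset.sum_nonneg fun i _ => Finset.sum_nonneg fun j _ => ?_
  have := cellMass_nonneg (γ := γ) x y z i j
  positivity

/-- The remainder lies between -L‖δ‖² and 0. -/
theorem hasGradientAt_dualObjective [Nonempty (Fin n)] [Nonempty (Fin m)] [IsFiniteMeasure γ]
    (hx : Function.Injective x) (hy : Function.Injective y) (hγ : HasBoundedPosDensity γ)
    (z : Param n m) :
    HasGradientAt (dualObjective a b x y γ) (explicitGradient a b x y γ z) z := by
  obtain ⟨L, hL, h⟩ := le_dualObjective_add hx hy hγ a b (‖z‖ + ‖z‖)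
  have hz : ∀ i j, alpha z i + beta z j ≤ ‖z‖ + ‖z‖ := fun i j =>
    add_le_add ((le_abs_self _).trans (abs_alpha_le_norm z i))
      ((le_abs_self _).trans (abs_beta_le_norm z j))
  rw [hasGradientAt_iff_isLittleO_nhds_zero]
  refine IsBigO.trans_isLittleO (g := fun δ : Param n m => ‖δ‖ ^ 2) ?_ ?_
  · refine IsBigO.of_bound L ?_
    filter_upwards [Metric.closedBall_mem_nhds (0 : Param n m) (by norm_num : (0 : ℝ) < 1 / 2)]
      with δ hδ
    have h1 := h z hz δ (by simpa using hδ)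
    have h2 := dualObjective_add_le_inner (a := a) (b := b) hx hy hγ z δ
    rw [Real.norm_eq_abs, Real.norm_of_nonneg (by positivity)]
    exact abs_le.2 ⟨by linarith, by nlinarith [sq_nonneg ‖δ‖]⟩
  · exact isLittleO_norm_pow_id one_lt_two

theorem inner_explicitGradient_oplusShift [Nonempty (Fin n)] [Nonempty (Fin m)]
    [IsFiniteMeasure γ]
    (hx : Function.Injective x) (hy : Function.Injective y) (hγ : HasBoundedPosDensity γ)
    (ha_sum : ∑ i, a i = 1) (hb_sum : ∑ j, b j = 1) (z : Param n m) (r : ℝ) :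
    inner ℝ (explicitGradient a b x y γ z) (oplusShift n m r) = 0 := by
  rw [inner_explicitGradient hx hy hγ]
  simp [← Finset.sum_mul, ha_sum, hb_sum]

/-- Shifts are orthogonal to the supergradient, so no shift increases U; the reverse shift gives
equality. -/
theorem dualObjective_add_oplusShift [Nonempty (Fin n)] [Nonempty (Fin m)] [IsFiniteMeasure γ]
    (hx : Function.Injective x) (hy : Function.Injective y) (hγ : HasBoundedPosDensity γ)
    (ha_sum : ∑ i, a i = 1) (hb_sum : ∑ j, b j = 1) (z : Param n m) (r : ℝ) :
    dualObjective a b x y γ (z + oplusShift n m r) = dualObjective a b x y γ z := by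
  have h : ∀ (z : Param n m) (r : ℝ),
      dualObjective a b x y γ (z + oplusShift n m r) ≤ dualObjective a b x y γ z := by
    intro z r
    have := dualObjective_add_le_inner (a := a) (b := b) hx hy hγ z (oplusShift n m r)
    rwa [inner_explicitGradient_oplusShift hx hy hγ ha_sum hb_sum, add_zero] at this
  refine le_antisymm (h z r) ?_
  have h2 := h (z + oplusShift n m r) (-r)
  have h3 : z + oplusShift n m r + oplusShift n m (-r) = z := by
    ext k
    rcases k with i | j <;> simp [oplusShift]
  rwa [h3] at h2

theorem exp_mul_integral_le [Nonempty (Fin n)] [Nonempty (Fin m)] [IsFiniteMeasure γ]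
    (z : Param n m) (i : Fin n) (j : Fin m) :
    Real.exp (alpha z i + beta z j) *
      ∫ q, Real.exp (inner ℝ q.1 (x i) + inner ℝ q.2 (y j) - ‖q.1‖ ^ 2 / 2 - ‖q.2‖ ^ 2 / 2) ∂γ ≤
      ∫ q, expIntegrand x y z q ∂γ := by
  rw [← integral_const_mul]
  refine integral_mono_of_nonneg (ae_of_all _ fun q => by positivity)
    (integrable_expIntegrand x y z) (ae_of_all _ fun q => ?_)
  have h1 := le_maxAffine x (alpha z) q.1 i
  have h2 := le_maxAffine y (beta z) q.2 j
  simp only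
  rw [expIntegrand, ← Real.exp_add, Real.exp_le_exp]
  linarith

theorem integral_exp_inner_pos [Nonempty (Fin n)] [Nonempty (Fin m)] [IsProbabilityMeasure γ]
    (i : Fin n) (j : Fin m) :
    0 < ∫ q, Real.exp
      (inner ℝ q.1 (x i) + inner ℝ q.2 (y j) - ‖q.1‖ ^ 2 / 2 - ‖q.2‖ ^ 2 / 2) ∂γ := by
  refine integral_exp_pos ((integrable_expIntegrand (γ := γ) x y 0).mono'
    (by fun_prop) (ae_of_all _ fun q => ?_))
  have h1 := le_maxAffine x (alpha (0 : Param n m)) q.1 i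
  have h2 := le_maxAffine y (beta (0 : Param n m)) q.2 j
  have h3 : alpha (0 : Param n m) i = 0 := rfl
  have h4 : beta (0 : Param n m) j = 0 := rfl
  rw [Real.norm_of_nonneg (Real.exp_pos _).le, expIntegrand, Real.exp_le_exp]
  linarith

/-- For t ≥ 0 the tangent bound c exp t ≥ 2(t + log(c/2) + 1) gives slope -1; for t < 0 drop the
exponential. -/
theorem sub_mul_exp_le {c : ℝ} (hc : 0 < c) : ∃ K, ∀ t, t - c * Real.exp t ≤ K - |t| := by
  refine ⟨2 * |Real.log (c / 2)|, fun t => ?_⟩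
  have h0 := neg_abs_le (Real.log (c / 2))
  have h3 := abs_nonneg (Real.log (c / 2))
  have h1 := Real.add_one_le_exp (t + Real.log (c / 2))
  rw [Real.exp_add, Real.exp_log (by positivity)] at h1
  have h2 : 0 < c * Real.exp t := by positivity
  rcases abs_cases t with ⟨h, _⟩ | ⟨h, _⟩ <;> rw [h] <;> linarith

/-- The weights a_i b_j have marginals a and b, so the linear part of U averages α_i + β_j, while
the integral dominates a multiple of exp(α_i + β_j) for each pair. -/
theorem dualObjective_coercive [Nonempty (Fin n)] [Nonempty (Fin m)] [IsProbabilityMeasure γ]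
    (ha : ∀ i, 0 < a i) (hb : ∀ j, 0 < b j) (ha_sum : ∑ i, a i = 1) (hb_sum : ∑ j, b j = 1) :
    ∃ K : ℝ, ∀ z : Param n m,
      dualObjective a b x y γ z ≤ K - ∑ i, ∑ j, a i * b j * |alpha z i + beta z j| := by
  choose K hK using fun (i : Fin n) (j : Fin m) =>
    sub_mul_exp_le (integral_exp_inner_pos (x := x) (y := y) (γ := γ) i j)
  refine ⟨∑ i, a i * (‖x i‖ ^ 2 / 2) + ∑ j, b j * (‖y j‖ ^ 2 / 2) + 1 +
    ∑ i, ∑ j, a i * b j * K i j, fun z => ?_⟩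
  have hA : ∑ i, a i * alpha z i = ∑ i, ∑ j, a i * b j * alpha z i := by
    refine Finset.sum_congr rfl fun i _ => ?_
    rw [← Finset.sum_mul, ← Finset.mul_sum, hb_sum, mul_one]
  have hB : ∑ j, b j * beta z j = ∑ i, ∑ j, a i * b j * beta z j := by
    rw [Finset.sum_comm]
    refine Finset.sum_congr rfl fun j _ => ?_
    rw [← Finset.sum_mul, ← Finset.sum_mul, ha_sum, one_mul]
  have hF : ∑ i, ∑ j, a i * b j * ∫ q, expIntegrand x y z q ∂γ =
      ∫ q, expIntegrand x y z q ∂γ := by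
    simp only [← Finset.sum_mul, ← Finset.mul_sum, ha_sum, hb_sum, mul_one, one_mul]
  have hsum : ∑ i, ∑ j, a i * b j * alpha z i + ∑ i, ∑ j, a i * b j * beta z j -
      ∑ i, ∑ j, a i * b j * ∫ q, expIntegrand x y z q ∂γ ≤
      ∑ i, ∑ j, a i * b j * K i j - ∑ i, ∑ j, a i * b j * |alpha z i + beta z j| := by
    simp only [← Finset.sum_add_distrib, ← Finset.sum_sub_distrib]
    refine Finset.sum_le_sum fun i _ => Finset.sum_le_sum fun j _ => ?_
    rw [← mul_add, ← mul_sub, ← mul_sub]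
    refine mul_le_mul_of_nonneg_left ?_ (mul_pos (ha i) (hb j)).le
    have h1 := hK i j (alpha z i + beta z j)
    have h2 := exp_mul_integral_le (x := x) (y := y) (γ := γ) z i j
    linarith
  rw [hF, ← hA, ← hB] at hsum
  rw [dualObjective]
  simp only [mul_add, Finset.sum_add_distrib]
  linarith

theorem exists_abs_alpha_add_beta_le [Nonempty (Fin n)] [Nonempty (Fin m)]
    [IsProbabilityMeasure γ]
    (ha : ∀ i, 0 < a i) (hb : ∀ j, 0 < b j) (ha_sum : ∑ i, a i = 1) (hb_sum : ∑ j, b j = 1)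
    (u₀ : ℝ) :
    ∃ T : ℝ, 0 ≤ T ∧ ∀ z : Param n m, u₀ ≤ dualObjective a b x y γ z →
      ∀ i j, |alpha z i + beta z j| ≤ T := by
  obtain ⟨K, hK⟩ := dualObjective_coercive (x := x) (y := y) (γ := γ) ha hb ha_sum hb_sum
  refine ⟨∑ i, ∑ j, |K - u₀| / (a i * b j), Finset.sum_nonneg fun i _ => Finset.sum_nonneg
    fun j _ => div_nonneg (abs_nonneg _) (mul_pos (ha i) (hb j)).le, fun z hz i j => ?_⟩
  have hnn : ∀ i j, 0 ≤ a i * b j * |alpha z i + beta z j| := fun i j =>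
    mul_nonneg (mul_pos (ha i) (hb j)).le (abs_nonneg _)
  have hnn' : ∀ i j, 0 ≤ |K - u₀| / (a i * b j) := fun i j =>
    div_nonneg (abs_nonneg _) (mul_pos (ha i) (hb j)).le
  have hsingle : ∀ f : Fin n → Fin m → ℝ, (∀ i j, 0 ≤ f i j) → f i j ≤ ∑ i, ∑ j, f i j :=
    fun f hf => (Finset.single_le_sum (fun j _ => hf i j) (Finset.mem_univ j)).trans
      (Finset.single_le_sum (f := fun i => ∑ j, f i j)
        (fun i _ => Finset.sum_nonneg fun j _ => hf i j) (Finset.mem_univ i))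
  refine le_trans ?_ (hsingle _ hnn')
  rw [le_div_iff₀ (mul_pos (ha i) (hb j)), mul_comm]
  have h1 := hsingle _ hnn
  have h2 := hK z
  have h3 := le_abs_self (K - u₀)
  linarith

/-- Any point with U at least U(0) can be shifted into a fixed ball, so a maximum over that ball is
global. -/
theorem exists_isDualOptimizer [Nonempty (Fin n)] [Nonempty (Fin m)] [IsProbabilityMeasure γ]
    (ha : ∀ i, 0 < a i) (hb : ∀ j, 0 < b j) (ha_sum : ∑ i, a i = 1) (hb_sum : ∑ j, b j = 1)
    (hx : Function.Injective x) (hy : Function.Injective y) (hγ : HasBoundedPosDensity γ) :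
    ∃ zs : Param n m, IsDualOptimizer a b x y γ zs := by
  obtain ⟨T, hT0, hT⟩ := exists_abs_alpha_add_beta_le (x := x) (y := y) (γ := γ) ha hb ha_sum
    hb_sum (dualObjective a b x y γ 0)
  have hcont : Continuous (dualObjective a b x y γ) := continuous_iff_continuousAt.2 fun z =>
    (hasGradientAt_dualObjective hx hy hγ z).continuousAt
  have hR : 0 ≤ √(n + m) * 2 * T := by positivity
  obtain ⟨zs, -, hzs⟩ := (isCompact_closedBall (0 : Param n m) (√(n + m) * 2 * T)).exists_isMaxOn
    ⟨0, by simpa using hR⟩ hcont.continuousOn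
  refine ⟨zs, fun w => ?_⟩
  rcases le_or_gt (dualObjective a b x y γ 0) (dualObjective a b x y γ w) with h | h
  · obtain ⟨i₀⟩ := ‹Nonempty (Fin n)›
    obtain ⟨j₀⟩ := ‹Nonempty (Fin m)›
    have : Nonempty (Fin n) := ⟨i₀⟩
    have : Nonempty (Fin m) := ⟨j₀⟩
    have h1 := norm_sub_oplusShift_le w hT0 (hT w h) i₀ j₀
    have h2 : dualObjective a b x y γ (w - oplusShift n m (alpha w i₀)) ≤
        dualObjective a b x y γ zs := hzs (by simpa using h1)
    rwa [← dualObjective_add_oplusShift hx hy hγ ha_sum hb_sum _ (alpha w i₀),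
      sub_add_cancel] at h2
  · exact h.le.trans (hzs (by simpa using hR))

theorem IsDualOptimizer.explicitGradient_eq_zero [Nonempty (Fin n)] [Nonempty (Fin m)]
    [IsFiniteMeasure γ]
    (hx : Function.Injective x) (hy : Function.Injective y) (hγ : HasBoundedPosDensity γ)
    {zs : Param n m} (hzs : IsDualOptimizer a b x y γ zs) : explicitGradient a b x y γ zs = 0 := by
  have h := (hasGradientAt_dualObjective (a := a) (b := b) hx hy hγ zs).hasFDerivAt
  have h0 := IsLocalMax.hasFDerivAt_eq_zero (Eventually.of_forall hzs) h
  simpa using h0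

/-- Zero gradient and positive a_i, b_j give each A_i and B_j positive volume. Although γ need not
be a product, it has the same null sets as Lebesgue measure, which is one. -/
theorem IsDualOptimizer.cellMass_pos [Nonempty (Fin n)] [Nonempty (Fin m)] [IsFiniteMeasure γ]
    (ha : ∀ i, 0 < a i) (hb : ∀ j, 0 < b j)
    (hx : Function.Injective x) (hy : Function.Injective y) (hγ : HasBoundedPosDensity γ)
    {zs : Param n m} (hzs : IsDualOptimizer a b x y γ zs) (i : Fin n) (j : Fin m) :
    0 < cellMass x y zs γ i j := by
  have hG := hzs.explicitGradient_eq_zero hx hy hγ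
  have h1 : a i - ∫ q in laguerreCell x (alpha zs) i ×ˢ Set.univ, expIntegrand x y zs q ∂γ = 0 :=
    congrArg (fun v : Param n m => v (Sum.inl i)) hG
  have h2 : b j - ∫ q in Set.univ ×ˢ laguerreCell y (beta zs) j, expIntegrand x y zs q ∂γ = 0 :=
    congrArg (fun v : Param n m => v (Sum.inr j)) hG
  have hA : volume (laguerreCell x (alpha zs) i) ≠ 0 := by
    intro h0
    have : γ (laguerreCell x (alpha zs) i ×ˢ Set.univ) = 0 :=
      hγ.absolutelyContinuous_volume (by
        rw [Measure.volume_eq_prod, Measure.prod_prod, h0, zero_mul])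
    rw [setIntegral_measure_zero _ this] at h1
    linarith [ha i]
  have hB : volume (laguerreCell y (beta zs) j) ≠ 0 := by
    intro h0
    have : γ (Set.univ ×ˢ laguerreCell y (beta zs) j) = 0 :=
      hγ.absolutelyContinuous_volume (by
        rw [Measure.volume_eq_prod, Measure.prod_prod, h0, mul_zero])
    rw [setIntegral_measure_zero _ this] at h2
    linarith [hb j]
  rw [cellMass, setIntegral_pos_iff_support_of_nonneg_ae
    (ae_of_all _ fun q => (expIntegrand_pos x y zs q).le)
    (integrable_expIntegrand x y zs).integrableOn]
  have : Function.support (expIntegrand x y zs) = Set.univ :=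
    Set.eq_univ_of_forall fun q => (expIntegrand_pos x y zs q).ne'
  rw [this, Set.univ_inter, pos_iff_ne_zero]
  intro h0
  have h3 := hγ.volume_absolutelyContinuous h0
  rw [prodCell, Measure.volume_eq_prod, Measure.prod_prod, mul_eq_zero] at h3
  exact h3.elim hA hB

theorem IsDualOptimizer.sum_cellMass_le [Nonempty (Fin n)] [Nonempty (Fin m)] [IsFiniteMeasure γ]
    (hx : Function.Injective x) (hy : Function.Injective y) (hγ : HasBoundedPosDensity γ)
    {zs : Param n m} (hzs : IsDualOptimizer a b x y γ zs) (z : Param n m) :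
    ∑ i, ∑ j, cellMass x y zs γ i j * ((alpha (z - zs) i + beta (z - zs) j) ^ 2 /
      (4 + 2 * |alpha (z - zs) i + beta (z - zs) j|)) ≤
      dualObjective a b x y γ zs - dualObjective a b x y γ z := by
  have h := dualObjective_add_le (a := a) (b := b) hx hy hγ zs (z - zs)
  rw [hzs.explicitGradient_eq_zero hx hy hγ, inner_zero_left, add_sub_cancel] at h
  linarith

theorem IsDualOptimizer.oplusEquiv [Nonempty (Fin n)] [Nonempty (Fin m)] [IsFiniteMeasure γ]
    (ha : ∀ i, 0 < a i) (hb : ∀ j, 0 < b j)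
    (hx : Function.Injective x) (hy : Function.Injective y) (hγ : HasBoundedPosDensity γ)
    {zs w : Param n m} (hzs : IsDualOptimizer a b x y γ zs) (hw : IsDualOptimizer a b x y γ w) :
    OplusEquiv w zs := by
  have h := (hzs.sum_cellMass_le hx hy hγ w).trans (sub_nonpos.2 (hw zs))
  have hnn : ∀ i j, 0 ≤ cellMass x y zs γ i j * ((alpha (w - zs) i + beta (w - zs) j) ^ 2 /
      (4 + 2 * |alpha (w - zs) i + beta (w - zs) j|)) := fun i j => by
    have := hzs.cellMass_pos ha hb hx hy hγ i j
    positivity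
  have h0 : ∀ i j, alpha (w - zs) i + beta (w - zs) j = 0 := by
    intro i j
    have h1 := (Finset.sum_eq_zero_iff_of_nonneg fun i _ => Finset.sum_nonneg fun j _ =>
      hnn i j).1 (le_antisymm h (Finset.sum_nonneg fun i _ => Finset.sum_nonneg fun j _ =>
      hnn i j)) i (Finset.mem_univ i)
    have h2 := (Finset.sum_eq_zero_iff_of_nonneg fun j _ => hnn i j).1 h1 j (Finset.mem_univ j)
    have h3 : 4 + 2 * |alpha (w - zs) i + beta (w - zs) j| ≠ 0 := by positivity
    simpa [(hzs.cellMass_pos ha hb hx hy hγ i j).ne', h3, -alpha_sub, -beta_sub] using h2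
  obtain ⟨i₀⟩ := ‹Nonempty (Fin n)›
  obtain ⟨j₀⟩ := ‹Nonempty (Fin m)›
  simp only [alpha_sub, beta_sub, Pi.sub_apply] at h0
  refine ⟨alpha w i₀ - alpha zs i₀, fun i => ?_, fun j => ?_⟩
  · linarith [h0 i j₀, h0 i₀ j₀]
  · linarith [h0 i₀ j]

theorem IsDualOptimizer.quadratic_growth [Nonempty (Fin n)] [Nonempty (Fin m)]
    [IsProbabilityMeasure γ]
    (ha : ∀ i, 0 < a i) (hb : ∀ j, 0 < b j) (ha_sum : ∑ i, a i = 1) (hb_sum : ∑ j, b j = 1)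
    (hx : Function.Injective x) (hy : Function.Injective y) (hγ : HasBoundedPosDensity γ)
    {zs : Param n m} (hzs : IsDualOptimizer a b x y γ zs) (u₀ : ℝ) :
    ∃ c : ℝ, 0 < c ∧ ∀ z : Param n m, u₀ ≤ dualObjective a b x y γ z →
      c * l2Oplus (z - zs) ^ 2 ≤ dualObjective a b x y γ zs - dualObjective a b x y γ z := by
  obtain ⟨T, hT0, hT⟩ := exists_abs_alpha_add_beta_le (x := x) (y := y) (γ := γ) ha hb ha_sum
    hb_sum u₀
  obtain ⟨ij, hij⟩ := Finite.exists_min fun ij : Fin n × Fin m => cellMass x y zs γ ij.1 ij.2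
  have hpos := hzs.cellMass_pos ha hb hx hy hγ ij.1 ij.2
  -- The smallest cell mass; the sums of both `z` and `zs` are bounded by `T`, so their differences
  -- by `2 * T`.
  refine ⟨cellMass x y zs γ ij.1 ij.2 / (4 + 2 * (2 * T)), by positivity, fun z hz => ?_⟩
  refine le_trans ?_ (hzs.sum_cellMass_le hx hy hγ z)
  rw [l2Oplus_sq, Finset.mul_sum]
  refine Finset.sum_le_sum fun i _ => ?_
  rw [Finset.mul_sum]
  refine Finset.sum_le_sum fun j _ => ?_
  have h1 : |alpha (z - zs) i + beta (z - zs) j| ≤ 2 * T := by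
    have h2 := abs_le.1 (hT z hz i j)
    have h3 := abs_le.1 (hT zs (hz.trans (hzs z)) i j)
    simp only [alpha_sub, beta_sub, Pi.sub_apply]
    exact abs_le.2 ⟨by linarith, by linarith⟩
  rw [div_mul_eq_mul_div, mul_div_assoc]
  have := hij (i, j)
  have := hzs.cellMass_pos ha hb hx hy hγ i j
  gcongr

/-- The supergradient inequality and Cauchy–Schwarz, with `zs` first shifted so that the Euclidean
distance to `z` is controlled by `l2Oplus`. -/
theorem sub_le_norm_explicitGradient [Nonempty (Fin n)] [Nonempty (Fin m)]
    [IsFiniteMeasure γ]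
    (ha_sum : ∑ i, a i = 1) (hb_sum : ∑ j, b j = 1)
    (hx : Function.Injective x) (hy : Function.Injective y) (hγ : HasBoundedPosDensity γ)
    (zs z : Param n m) :
    dualObjective a b x y γ zs - dualObjective a b x y γ z ≤
      (√(n + m) * 2) * ‖explicitGradient a b x y γ z‖ * l2Oplus (z - zs) := by
  obtain ⟨i₀⟩ := id ‹Nonempty (Fin n)›
  obtain ⟨j₀⟩ := id ‹Nonempty (Fin m)›
  have h1 := norm_sub_oplusShift_le (z - zs) (l2Oplus_nonneg _)
    (abs_alpha_add_beta_le_l2Oplus (z - zs)) i₀ j₀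
  set s := oplusShift n m (alpha (z - zs) i₀) with hs
  have h2 := dualObjective_add_le_inner (a := a) (b := b) hx hy hγ z (-(z - zs - s))
  have h3 : z + -(z - zs - s) = zs + s := by abel
  rw [h3, hs, dualObjective_add_oplusShift hx hy hγ ha_sum hb_sum, ← hs] at h2
  have h4 := real_inner_le_norm (explicitGradient a b x y γ z) (-(z - zs - s))
  rw [norm_neg] at h4
  have h5 := mul_le_mul_of_nonneg_left h1 (norm_nonneg (explicitGradient a b x y γ z))
  linarith

end Dual

end RelaxedBridge

end

open RelaxedBridge in
theorem proposition5p2 {n m d : ℕ}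
    (a : Fin n → ℝ) (b : Fin m → ℝ)
    (x : Fin n → EuclideanSpace ℝ (Fin d)) (y : Fin m → EuclideanSpace ℝ (Fin d))
    (ha : ∀ i, 0 < a i) (hb : ∀ j, 0 < b j)
    (ha_sum : ∑ i, a i = 1) (hb_sum : ∑ j, b j = 1)
    (hx : Function.Injective x) (hy : Function.Injective y)
    (γ : Measure (EuclideanSpace ℝ (Fin d) × EuclideanSpace ℝ (Fin d)))
    [IsProbabilityMeasure γ]
    (ρ : EuclideanSpace ℝ (Fin d) × EuclideanSpace ℝ (Fin d) → ℝ)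
    (hγ : γ = volume.withDensity (fun q => ENNReal.ofReal (ρ q)))
    (hρ_cont : Continuous ρ) (hρ_bdd : ∃ C : ℝ, ∀ q, ρ q ≤ C) (hρ_pos : ∀ q, 0 < ρ q) :
    (∀ z : RelaxedBridge.Param n m,
      HasGradientAt (RelaxedBridge.dualObjective a b x y γ)
        (RelaxedBridge.explicitGradient a b x y γ z) z) ∧
    ∃ zs : RelaxedBridge.Param n m,
      RelaxedBridge.IsDualOptimizer a b x y γ zs ∧
      (∀ w, RelaxedBridge.IsDualOptimizer a b x y γ w → RelaxedBridge.OplusEquiv w zs) ∧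
      ∀ z₀ : RelaxedBridge.Param n m, ∃ η₀ : ℝ, 0 < η₀ ∧
        ∀ η : ℝ, 0 < η → η < η₀ →
          ∃ θ ∈ Set.Ioo (0 : ℝ) 1,
            (fun t : ℕ => RelaxedBridge.l2Oplus
              (RelaxedBridge.gradientAscent a b x y γ η z₀ t - zs))
              =O[atTop] (fun t : ℕ => θ ^ t) := by
  have hn : Nonempty (Fin n) := by
    by_contra h
    rw [not_nonempty_iff] at h
    simp at ha_sum
  have hm : Nonempty (Fin m) := by
    by_contra h
    rw [not_nonempty_iff] at h
    simp at hb_sum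
  have hγ' : HasBoundedPosDensity γ := ⟨ρ, hρ_cont.measurable, hρ_bdd, hρ_pos, hγ⟩
  have hgrad := hasGradientAt_dualObjective (a := a) (b := b) hx hy hγ'
  obtain ⟨zs, hzs⟩ := exists_isDualOptimizer ha hb ha_sum hb_sum hx hy hγ'
  refine ⟨hgrad, zs, hzs, fun w hw => hzs.oplusEquiv ha hb hx hy hγ' hw, fun z₀ => ?_⟩
  -- All constants refer to the superlevel set of the starting value, which is why the step-size
  -- threshold depends on `z₀`.
  obtain ⟨T, -, hT⟩ := exists_abs_alpha_add_beta_le (x := x) (y := y) (γ := γ) ha hb ha_sum hb_sum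
    (dualObjective a b x y γ z₀)
  obtain ⟨L, hL, hsmooth⟩ := le_dualObjective_add hx hy hγ' a b T
  obtain ⟨c, hc, hgrowth⟩ := hzs.quadratic_growth ha hb ha_sum hb_sum hx hy hγ'
    (dualObjective a b x y γ z₀)
  have hC : 0 < √((n : ℝ) + m) * 2 := by
    have : 0 < n := Fin.pos_iff_nonempty.2 hn
    positivity
  obtain ⟨η₀, hη₀, h⟩ := gradientAscent_linear_rate (N := fun z => l2Oplus (z - zs))
    hL hc hC hzs
    (fun z hz => hsmooth z fun i j => (le_abs_self _).trans (hT z hz i j))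
    (fun z _ => sub_le_norm_explicitGradient ha_sum hb_sum hx hy hγ' zs z) hgrowth
  refine ⟨η₀, hη₀, fun η hη hlt => ?_⟩
  obtain ⟨θ, hθ, hrate⟩ := h η hη hlt
  refine ⟨θ, hθ, ?_⟩
  obtain ⟨D, hD⟩ := hrate (gradientAscent a b x y γ η z₀) le_rfl fun t => by
    rw [gradientAscent, (hgrad _).gradient]
  refine IsBigO.of_bound D (Eventually.of_forall fun t => ?_)
  rw [Real.norm_of_nonneg (l2Oplus_nonneg _), Real.norm_of_nonneg (pow_nonneg hθ.1.le t)]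
  exact hD t
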